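/- Let $p$ be a prime, $a\ge 1$, $q=p^a$. Let $n \ge 1$, $d_1,\dots,d_n\ge 1$ be integers, and $d=\operatorname{lcm}(d_1,\dots,d_n)$. For an integer $b\ge 0$ let $\sigma_p(b)$ be the sum of the base-$p$ digits of $b$. For a polynomial $F=\sum_u c_u x^u\in\mathbb F_{q^d}[x_1,\dots,x_n]$ let $$w_p(F)=\max_{u:\,c_u\ne 0}\bigl(\sigma_p(u_1)+\cdots+\sigma_p(u_n)\bigr)$$ be its $p$-weight, with $w_p(0)=0$. Let $F_1,\dots,F_r\in\mathbb F_{q^d}[x_1,\dots,x_n]$, not all constant, and let $$N_1(\mathbf d)=\#\{x\in\mathbb F_{q^{d_1}}\times\cdots\times\mathbb F_{q^{d_n}} : F_1(x)=\cdots=F_r(x)=0\},$$ where each $\mathbb F_{q^{d_i}}$ is viewed as a subfield of $\mathbb F_{q^d}$. Set $$\omega=\left\lceil a\cdot\frac{(d_1+\cdots+d_n)-d\sum_{i=1}^r w_p(F_i)}{\max_{i} w_p(F_i)}\right\rceil .$$ Then $p^{\omega}$ divides $N_1(\mathbf d)$ (if $\omega\le 0$, nothing is asserted). -/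

import Mathlib

/-- `σ_p(b)`: the sum of the base-`p` digits of `b`. -/
def digitSum (p b : ℕ) : ℕ := (Nat.digits p b).sum

/-- `|σ_p(u)| = σ_p(u_1) + ⋯ + σ_p(u_n)` for an exponent vector `u`. -/
def expWeight {n : ℕ} (p : ℕ) (u : Fin n →₀ ℕ) : ℕ := ∑ i, digitSum p (u i)

/-- The `p`-weight `w_p(F)`: the maximum of `|σ_p(u)|` over the exponent vectors `u` of the monomials
that occur in `F` with nonzero coefficient (and `w_p(0) = 0`). -/
def pWeight {n : ℕ} {K : Type*} [Field K] (p : ℕ) (F : MvPolynomial (Fin n) K) : ℕ :=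
  F.support.sup (expWeight p)

/-- `max_i w_p(F_i)` for a family of polynomials. -/
def maxPWeight {n r : ℕ} {K : Type*} [Field K] (p : ℕ)
    (F : Fin r → MvPolynomial (Fin n) K) : ℕ :=
  Finset.univ.sup fun j => pWeight p (F j)

/-- The number of common zeros of the `F_j` whose `i`-th coordinate lies in the subfield `L i`. -/
noncomputable def partialCount {n r : ℕ} {K : Type*} [Field K] (L : Fin n → Subfield K)
    (F : Fin r → MvPolynomial (Fin n) K) : ℕ :=
  Nat.card {x : (i : Fin n) → L i // ∀ j, MvPolynomial.eval (fun i => (x i : K)) (F j) = 0}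

/-- The exponent `⌈a * ((d_1 + ⋯ + d_n) - d * ∑ w_p(F_i)) / max w_p(F_i)⌉`, an integer (possibly
negative), where `d` is the least common multiple of the `d_i`. -/
def omegaBound {n r : ℕ} {K : Type*} [Field K] (p a : ℕ) (d : Fin n → ℕ)
    (F : Fin r → MvPolynomial (Fin n) K) : ℤ :=
  ⌈(a : ℚ) * (((∑ i, (d i : ℚ)) - (Finset.univ.lcm d : ℕ) * ∑ j, (pWeight p (F j) : ℚ)) /
    (maxPWeight p F : ℚ))⌉

/-! Weil restriction reduces the claim to an Ax–Katz theorem over the prime field. In `ZMod p`-bases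
of the `L i` and of `K`, the unknowns become `a * ∑ d i` scalars and each `F j` becomes `a * lcm d`
equations. Since Frobenius is linear over `ZMod p`, a `k`-th power of a linear form costs only
degree `digitSum p k`, so these equations have degree at most `pWeight p (F j)`.

Over `ZMod p` (`ax_katz_zmod`) the count is done modulo `p ^ m`. Fleck's congruence writes the
indicator of `p ∣ t` as `∑ c k * t.choose k` with `c k` increasingly divisible by `p`. Each equation
is lifted to a sum of Teichmüller representatives, whose binomial coefficients are polynomials of
controlled degree in the Teichmüller coordinates. Low-degree polynomials have highly divisible sums
over all points (`pow_dvd_sum_of_isPolyIn`), and the two sources of divisibility together give `p ^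
m` in every term. -/

/-! ### Finite differences and Fleck's congruence -/

/-- Periodicity gives `∑_{1 ≤ j ≤ p} C(p,j) Δ^j g = 0`; solving for `Δ^p g` leaves only coefficients
divisible by `p`, and one `Δ` factors out. Each factor `p` thus costs `p - 1` differences. -/
theorem exists_fwdDiff_iter_prime_eq {p : ℕ} (hp : p.Prime) (g : ℕ → ℤ)
    (hg : ∀ t, g (t + p) = g t) :
    ∃ h : ℕ → ℤ, (∀ t, h (t + p) = h t) ∧ (fwdDiff 1)^[p] g = (p : ℤ) • fwdDiff 1 h := by
  have hper : ∀ k t, (fwdDiff 1)^[k] g (t + p) = (fwdDiff 1)^[k] g t := by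
    intro k
    induction k with
    | zero => exact hg
    | succ k ih =>
      intro t
      simp only [Function.iterate_succ_apply', fwdDiff]
      rw [add_right_comm, ih, ih]
  obtain ⟨q, rfl⟩ : ∃ q, p = q + 1 := ⟨p - 1, by have := hp.pos; omega⟩
  refine ⟨fun t => -∑ j ∈ Finset.range q,
    (((q + 1).choose (j + 1) / (q + 1) : ℕ) : ℤ) * (fwdDiff 1)^[j] g t, ?_, ?_⟩
  · intro t
    simp only [hper]
  · funext t
    have h1 := shift_eq_sum_fwdDiff_iter (1 : ℕ) g (q + 1) t
    rw [Finset.sum_range_succ, Finset.sum_range_succ'] at h1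
    simp only [smul_eq_mul, mul_one, hg, Nat.choose_zero_right, Function.iterate_zero, id,
      one_smul, Nat.choose_self] at h1
    have h2 : ∀ j ∈ Finset.range q, (q + 1).choose (j + 1) • (fwdDiff 1)^[j + 1] g t =
        ((q + 1 : ℕ) : ℤ) * ((((q + 1).choose (j + 1) / (q + 1) : ℕ) : ℤ) *
          (fwdDiff 1)^[j + 1] g t) := by
      intro j hj
      have hd : (q + 1) ∣ (q + 1).choose (j + 1) :=
        hp.dvd_choose_self (by omega) (by simpa using hj)
      rw [nsmul_eq_mul, ← mul_assoc, ← Nat.cast_mul, Nat.mul_div_cancel' hd]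
    rw [Finset.sum_congr rfl h2, ← Finset.mul_sum] at h1
    have h3 : fwdDiff 1 (fun t => -∑ j ∈ Finset.range q,
        (((q + 1).choose (j + 1) / (q + 1) : ℕ) : ℤ) * (fwdDiff 1)^[j] g t) t =
        -∑ j ∈ Finset.range q, (((q + 1).choose (j + 1) / (q + 1) : ℕ) : ℤ) *
          (fwdDiff 1)^[j + 1] g t := by
      simp only [Function.iterate_succ_apply', fwdDiff, mul_sub, Finset.sum_sub_distrib]
      ring
    rw [Pi.smul_apply, h3, smul_eq_mul]
    linarith

/-- The iterated differences of a `p`-periodic function are highly divisible by `p`. -/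
theorem pow_dvd_fwdDiff_iter {p : ℕ} (hp : p.Prime) (s : ℕ) (g : ℕ → ℤ)
    (hg : ∀ t, g (t + p) = g t) (t : ℕ) :
    (p : ℤ) ^ s ∣ (fwdDiff 1)^[(p - 1) * s + 1] g t := by
  induction s generalizing g t with
  | zero => simp
  | succ s ih =>
    obtain ⟨h, hh, e⟩ := exists_fwdDiff_iter_prime_eq hp g hg
    have h1 : (p - 1) * (s + 1) + 1 = (p - 1) * s + p := by
      have := hp.pos
      rw [mul_add, mul_one]; omega
    rw [h1, Function.iterate_add_apply, e, fwdDiff_iter_const_smul, Pi.smul_apply, smul_eq_mul,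
      ← Function.iterate_succ_apply, pow_succ']
    exact mul_dvd_mul_left _ (ih h hh t)

/-- Fleck's congruence: the binomial expansion of the indicator function of `pℕ`. -/
theorem exists_indicator_dvd_eq_sum_choose {p : ℕ} (hp : p.Prime) :
    ∃ c : ℕ → ℤ, (∀ k, (p : ℤ) ^ ((k - 1) / (p - 1)) ∣ c k) ∧
      ∀ t B : ℕ, t < B →
        (if p ∣ t then 1 else 0 : ℤ) = ∑ k ∈ Finset.range B, c k * (t.choose k : ℤ) := by
  set g : ℕ → ℤ := fun t => if p ∣ t then 1 else 0 with hg
  have hper : ∀ t, g (t + p) = g t := fun t => by simp [hg]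
  refine ⟨fun k => (fwdDiff 1)^[k] g 0, fun k => ?_, fun t B htB => ?_⟩
  · rcases k with _ | k
    · simp
    · have hk : k = k % (p - 1) + (p - 1) * (k / (p - 1)) := (Nat.mod_add_div _ _).symm
      have : (fwdDiff 1)^[k + 1] g =
          (fwdDiff 1)^[(p - 1) * (k / (p - 1)) + 1] ((fwdDiff 1)^[k % (p - 1)] g) := by
        rw [← Function.iterate_add_apply]
        congr 1
        omega
      simp only [add_tsub_cancel_right, this]
      apply pow_dvd_fwdDiff_iter hp
      generalize k % (p - 1) = j
      induction j with
      | zero => exact hper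
      | succ j ih =>
        intro t
        simp only [Function.iterate_succ_apply', fwdDiff]
        rw [add_right_comm, ih, ih]
  · have h1 := shift_eq_sum_fwdDiff_iter (1 : ℕ) g t 0
    simp only [smul_eq_mul, mul_one, zero_add, nsmul_eq_mul] at h1
    change g t = _
    rw [h1]
    rw [← Finset.sum_subset (Finset.range_subset_range.2 (Nat.succ_le_of_lt htB))]
    · exact Finset.sum_congr rfl fun k _ => mul_comm _ _
    · intro k _ hk
      rw [Nat.choose_eq_zero_of_lt (by simpa using hk)]
      simp

/-! ### Functions of bounded degree and their sums over all points -/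

/-- `g` is given by a polynomial of total degree at most `k` in the `T (x i)`. -/
def IsPolyIn {σ R A : Type*} [CommRing A] (T : R → A) (k : ℕ) (g : (σ → R) → A) : Prop :=
  ∃ P : MvPolynomial σ A, P.totalDegree ≤ k ∧ ∀ x, MvPolynomial.eval (fun i => T (x i)) P = g x

namespace IsPolyIn

variable {σ R A : Type*} [CommRing A] {T : R → A}

theorem mono {k l : ℕ} {g : (σ → R) → A} (h : IsPolyIn T k g) (hkl : k ≤ l) : IsPolyIn T l g :=
  let ⟨P, h1, h2⟩ := h
  ⟨P, h1.trans hkl, h2⟩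

theorem const (k : ℕ) (a : A) : IsPolyIn T k (fun _ : σ → R => a) :=
  ⟨MvPolynomial.C a, by simp, fun x => by simp⟩

theorem mul {k l : ℕ} {g h : (σ → R) → A} (hg : IsPolyIn T k g) (hh : IsPolyIn T l h) :
    IsPolyIn T (k + l) (fun x => g x * h x) := by
  obtain ⟨P, h1, h2⟩ := hg
  obtain ⟨Q, h3, h4⟩ := hh
  exact ⟨P * Q, (MvPolynomial.totalDegree_mul _ _).trans (add_le_add h1 h3), fun x => by simp [h2, h4]⟩

theorem pow {k : ℕ} {g : (σ → R) → A} (hg : IsPolyIn T k g) (e : ℕ) :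
    IsPolyIn T (e * k) (fun x => g x ^ e) := by
  obtain ⟨P, h1, h2⟩ := hg
  exact ⟨P ^ e, (MvPolynomial.totalDegree_pow _ _).trans (Nat.mul_le_mul_left _ h1),
    fun x => by simp [h2]⟩

theorem sum {α : Type*} (s : Finset α) {k : ℕ} {g : α → (σ → R) → A}
    (hg : ∀ a ∈ s, IsPolyIn T k (g a)) : IsPolyIn T k (fun x => ∑ a ∈ s, g a x) := by
  classical
  induction s using Finset.induction_on with
  | empty => simpa using const (T := T) (σ := σ) k 0
  | insert a s ha ih =>
    obtain ⟨P, h1, h2⟩ := hg a (by simp)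
    obtain ⟨Q, h3, h4⟩ := ih fun b hb => hg b (by simp [hb])
    refine ⟨P + Q, (MvPolynomial.totalDegree_add _ _).trans (max_le h1 h3), fun x => ?_⟩
    simp [Finset.sum_insert ha, h2, h4]

theorem prod {α : Type*} (s : Finset α) {k : α → ℕ} {g : α → (σ → R) → A}
    (hg : ∀ a ∈ s, IsPolyIn T (k a) (g a)) :
    IsPolyIn T (∑ a ∈ s, k a) (fun x => ∏ a ∈ s, g a x) := by
  classical
  induction s using Finset.induction_on with
  | empty => simpa using const (T := T) (σ := σ) 0 1
  | insert a s ha ih =>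
    simp only [Finset.sum_insert ha, Finset.prod_insert ha]
    exact (hg a (by simp)).mul (ih fun b hb => hg b (by simp [hb]))

theorem apply (i : σ) : IsPolyIn T 1 (fun x : σ → R => T (x i)) := by
  classical
  rcases subsingleton_or_nontrivial A with _ | _
  · exact ⟨0, by simp, fun x => Subsingleton.elim _ _⟩
  · exact ⟨MvPolynomial.X i, by simp, fun x => by simp⟩

theorem polynomial_eval {k : ℕ} {g : (σ → R) → A} (hg : IsPolyIn T k g) {e : ℕ}
    (Q : Polynomial A) (hQ : Q.natDegree ≤ e) : IsPolyIn T (e * k) (fun x => Q.eval (g x)) := by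
  simp only [Polynomial.eval_eq_sum_range]
  refine sum _ fun j hj => ?_
  have hj : j ≤ e := (Nat.lt_succ_iff.1 (Finset.mem_range.1 hj)).trans hQ
  simpa using ((const 0 (Q.coeff j)).mul (hg.pow j)).mono
    (by rw [zero_add]; exact Nat.mul_le_mul_right _ hj)

end IsPolyIn

/-- The sum of a monomial factors over the coordinates, and every exponent below `p - 1` contributes
a factor `p`. The degree bound leaves at most `E` coordinates with a larger exponent. -/
theorem pow_dvd_sum_of_isPolyIn {σ R A : Type*} [Fintype σ] [DecidableEq σ] [Fintype R] [CommRing A]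
    {T : R → A} {p : ℕ} (hp : 1 < p) (hT : ∀ e < p - 1, (p : A) ∣ ∑ y, T y ^ e)
    {E : ℕ} {g : (σ → R) → A} (hg : IsPolyIn T ((p - 1) * E) g) :
    (p : A) ^ (Fintype.card σ - E) ∣ ∑ x, g x := by
  classical
  obtain ⟨P, hP, hPg⟩ := hg
  simp only [← hPg, MvPolynomial.eval_eq']
  rw [Finset.sum_comm]
  refine Finset.dvd_sum fun d hd => ?_
  rw [← Finset.mul_sum]
  refine Dvd.dvd.mul_left ?_ _
  have hprod : ∑ x : σ → R, ∏ i, T (x i) ^ d i = ∏ i, ∑ y, T y ^ d i := by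
    rw [Finset.prod_univ_sum, Fintype.piFinset_univ]
  rw [hprod]
  set S := Finset.univ.filter fun i => d i < p - 1 with hS
  have hcard : Fintype.card σ - E ≤ S.card := by
    have h1 : S.card + (Finset.univ.filter fun i => ¬ d i < p - 1).card = Fintype.card σ := by
      rw [hS, Finset.card_filter_add_card_filter_not, Finset.card_univ]
    have h2 : (Finset.univ.filter fun i => ¬ d i < p - 1).card * (p - 1) ≤ (p - 1) * E := by
      calc _ ≤ ∑ i ∈ Finset.univ.filter fun i => ¬ d i < p - 1, d i := by
            rw [← smul_eq_mul]
            exact Finset.card_nsmul_le_sum _ _ _ fun i hi => by simpa using hi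
        _ ≤ ∑ i, d i := Finset.sum_le_sum_of_subset (Finset.filter_subset _ _)
        _ = d.sum fun _ e => e := (Finsupp.sum_fintype d (fun _ e => e) fun _ => rfl).symm
        _ ≤ _ := (MvPolynomial.le_totalDegree hd).trans hP
    rw [mul_comm] at h2
    have h3 := Nat.le_of_mul_le_mul_left h2 (by omega)
    omega
  calc (p : A) ^ (Fintype.card σ - E) ∣ p ^ S.card := pow_dvd_pow _ hcard
    _ = ∏ i ∈ S, (p : A) := by simp
    _ ∣ ∏ i ∈ S, ∑ y, T y ^ d i := Finset.prod_dvd_prod_of_dvd _ _ fun i hi => hT _ (by simpa [hS] using hi)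
    _ ∣ _ := Finset.prod_dvd_prod_of_subset _ _ _ (Finset.filter_subset _ _)

/-! ### Teichmüller lifts modulo `p ^ m` -/

/-- A natural number representing modulo `p ^ m` the Teichmüller lift of `y`. -/
def teichmullerNat {p : ℕ} (m : ℕ) (y : ZMod p) : ℕ := y.val ^ p ^ m

section Teichmuller

variable {p : ℕ} [hp : Fact p.Prime] (m : ℕ)

theorem cast_teichmullerNat (y : ZMod p) : (teichmullerNat m y : ZMod p) = y := by
  simp [teichmullerNat, ZMod.pow_card_pow]

/-- Integers congruent modulo `p` have `p ^ m`-th powers congruent modulo `p ^ (m + 1)`, so any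
representative of `y` may be used; multiplicativity follows. -/
theorem cast_teichmullerNat_eq {y : ZMod p} {t : ℕ} (h : (t : ZMod p) = y) :
    (teichmullerNat m y : ZMod (p ^ m)) = (t : ZMod (p ^ m)) ^ p ^ m := by
  have h1 : (p : ℤ) ∣ (y.val : ℤ) - t := by
    rw [← ZMod.intCast_zmod_eq_zero_iff_dvd, Int.cast_sub]
    simp [h]
  have h2 := (pow_dvd_pow (p : ℤ) (Nat.le_succ m)).trans (dvd_sub_pow_of_dvd_sub h1 m)
  rw [← Nat.cast_pow, ← sub_eq_zero]
  rw [← Nat.cast_pow p m] at h2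
  have h3 := (ZMod.intCast_zmod_eq_zero_iff_dvd _ _).2 h2
  simpa [teichmullerNat] using h3

theorem teichmullerNat_mul (y z : ZMod p) : (teichmullerNat m (y * z) : ZMod (p ^ m)) =
    teichmullerNat m y * teichmullerNat m z := by
  rw [cast_teichmullerNat_eq m (t := y.val * z.val) (by simp)]
  simp [teichmullerNat, mul_pow]

theorem teichmullerNat_one : (teichmullerNat m (1 : ZMod p) : ZMod (p ^ m)) = 1 := by
  rw [cast_teichmullerNat_eq m (t := 1) (by simp)]
  simp

/-- The Teichmüller lift modulo `p ^ m`. -/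
def teichmullerMod : ZMod p →* ZMod (p ^ m) where
  toFun y := teichmullerNat m y
  map_one' := teichmullerNat_one m
  map_mul' := teichmullerNat_mul m

theorem teichmullerMod_apply (y : ZMod p) : teichmullerMod m y = teichmullerNat m y := rfl

theorem dvd_sum_teichmullerMod_pow {e : ℕ} (he : e < p - 1) :
    (p : ZMod (p ^ m)) ∣ ∑ y : ZMod p, teichmullerMod m y ^ e := by
  have h1 : ((∑ y : ZMod p, teichmullerNat m y ^ e : ℕ) : ZMod p) = 0 := by
    push_cast
    simp only [cast_teichmullerNat]
    exact FiniteField.sum_pow_lt_card_sub_one _ _ (by simpa [ZMod.card] using he)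
  have h2 := (ZMod.natCast_eq_zero_iff _ _).1 h1
  have h3 := Nat.cast_dvd_cast (α := ZMod (p ^ m)) h2
  simpa [teichmullerMod_apply] using h3

theorem isUnit_intCast_zmod_pow {z : ℤ} (hz : (z : ZMod p) ≠ 0) :
    IsUnit (z : ZMod (p ^ m)) := by
  have h1 : ¬ (p : ℤ) ∣ z := fun h => hz ((ZMod.intCast_zmod_eq_zero_iff_dvd _ _).2 h)
  have h2 : IsCoprime (p : ℤ) z :=
    (Nat.prime_iff_prime_int.1 hp.out).coprime_iff_not_dvd.2 h1
  obtain ⟨u, v, h⟩ := h2.pow_left (m := m)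
  have h3 := congrArg (Int.cast : ℤ → ZMod (p ^ m)) h
  push_cast at h3
  have h4 : (p : ZMod (p ^ m)) ^ m = 0 := by
    rw [← Nat.cast_pow]; exact ZMod.natCast_self _
  rw [h4, mul_zero, zero_add] at h3
  exact IsUnit.of_mul_eq_one_right _ h3

/-- Every function on `ZMod p` is a polynomial of degree less than `p` in the Teichmüller lift. -/
theorem exists_polynomial_eval_teichmullerMod (g : ZMod p → ZMod (p ^ m)) :
    ∃ Q : Polynomial (ZMod (p ^ m)), Q.natDegree ≤ p - 1 ∧
      ∀ y, Q.eval (teichmullerMod m y) = g y := by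
  classical
  -- Lagrange interpolation is possible because the nodes are distinct modulo `p`, so their
  -- differences are units modulo `p ^ m`.
  have hu : ∀ y : ZMod p, IsUnit (∏ z ∈ Finset.univ.erase y,
      (teichmullerMod m y - teichmullerMod m z)) := by
    intro y
    refine IsUnit.prod_iff.2 fun z hz => ?_
    have h1 := isUnit_intCast_zmod_pow (p := p) m
      (z := (teichmullerNat m y : ℤ) - teichmullerNat m z) (by
        push_cast
        rw [cast_teichmullerNat, cast_teichmullerNat, sub_ne_zero]
        exact (Finset.ne_of_mem_erase hz).symm)
    simpa [teichmullerMod_apply] using h1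
  refine ⟨∑ y, Polynomial.C (g y * ((hu y).unit⁻¹ : (ZMod (p ^ m))ˣ)) *
    ∏ z ∈ Finset.univ.erase y, (Polynomial.X - Polynomial.C (teichmullerMod m z)), ?_, ?_⟩
  · refine Polynomial.natDegree_sum_le_of_forall_le _ _ fun y _ => ?_
    refine (Polynomial.natDegree_C_mul_le _ _).trans ((Polynomial.natDegree_prod_le _ _).trans ?_)
    refine (Finset.sum_le_card_nsmul _ _ 1 fun z _ => Polynomial.natDegree_X_sub_C_le _).trans ?_
    simp [Finset.card_erase_of_mem, ZMod.card]
  · intro y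
    rw [Polynomial.eval_finsetSum, Finset.sum_eq_single y]
    · simp only [Polynomial.eval_mul, Polynomial.eval_C, Polynomial.eval_prod,
        Polynomial.eval_sub, Polynomial.eval_X]
      rw [mul_assoc, IsUnit.val_inv_mul, mul_one]
    · intro z _ hz
      simp only [Polynomial.eval_mul, Polynomial.eval_prod]
      refine mul_eq_zero_of_right _ (Finset.prod_eq_zero (i := y) ?_ ?_)
      · simp [hz.symm]
      · simp
    · simp

/-- For `k < p`, `k!` is invertible and the falling factorial serves; for `k ≥ p`, interpolation at
the `p` nodes already has degree below `k`. -/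
theorem exists_polynomial_choose_teichmullerNat (k : ℕ) :
    ∃ Q : Polynomial (ZMod (p ^ m)), Q.natDegree ≤ k ∧
      ∀ y : ZMod p, Q.eval (teichmullerMod m y) = ((teichmullerNat m y).choose k : ℕ) := by
  rcases lt_or_ge k p with hk | hk
  · have hu : IsUnit (((k.factorial : ℕ) : ℤ) : ZMod (p ^ m)) := by
      refine isUnit_intCast_zmod_pow m ?_
      rw [Int.cast_natCast, Ne, ZMod.natCast_eq_zero_iff, hp.out.dvd_factorial]
      omega
    rw [Int.cast_natCast] at hu
    refine ⟨Polynomial.C ((hu.unit⁻¹ : (ZMod (p ^ m))ˣ) : ZMod (p ^ m)) *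
      descPochhammer (ZMod (p ^ m)) k, ?_, fun y => ?_⟩
    · refine (Polynomial.natDegree_C_mul_le _ _).trans ?_
      rw [← descPochhammer_map (Int.castRingHom (ZMod (p ^ m)))]
      exact Polynomial.natDegree_map_le.trans (descPochhammer_natDegree ℤ k).le
    · rw [teichmullerMod_apply, Polynomial.eval_mul, Polynomial.eval_C,
        descPochhammer_eval_eq_descFactorial, Nat.descFactorial_eq_factorial_mul_choose,
        Nat.cast_mul, ← mul_assoc, IsUnit.val_inv_mul, one_mul]
  · obtain ⟨Q, h1, h2⟩ := exists_polynomial_eval_teichmullerMod (p := p) m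
      fun y => ((teichmullerNat m y).choose k : ℕ)
    exact ⟨Q, by omega, h2⟩

/-- A polynomial `f` of degree at most `d` lifts to a function `t` all of whose binomial
coefficients are polynomials modulo `p ^ m` in the Teichmüller coordinates. -/
theorem exists_lift_isPolyIn_choose {σ : Type*} [Fintype σ] (f : MvPolynomial σ (ZMod p)) {d : ℕ}
    (hd : f.totalDegree ≤ d) :
    ∃ t : (σ → ZMod p) → ℕ, (∀ x, (t x : ZMod p) = MvPolynomial.eval x f) ∧
      ∀ k, IsPolyIn (teichmullerMod (p := p) m) (k * d)
        (fun x => ((t x).choose k : ZMod (p ^ m))) := by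
  classical
  let M : (σ →₀ ℕ) → (σ → ZMod p) → ZMod p := fun u x => f.coeff u * ∏ i, x i ^ u i
  refine ⟨fun x => ∑ u ∈ f.support, teichmullerNat m (M u x), fun x => ?_, ?_⟩
  · simp only [Nat.cast_sum, cast_teichmullerNat, MvPolynomial.eval_eq', M]
  · have key : ∀ u ∈ f.support, ∀ k, IsPolyIn (teichmullerMod (p := p) m) (k * d)
        (fun x => ((teichmullerNat m (M u x)).choose k : ZMod (p ^ m))) := by
      intro u hu k
      obtain ⟨Q, hQ, hQe⟩ := exists_polynomial_choose_teichmullerNat (p := p) m k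
      simp only [← hQe]
      refine IsPolyIn.polynomial_eval ?_ Q hQ
      have hM : ∀ x, teichmullerMod m (M u x) =
          teichmullerMod m (f.coeff u) * ∏ i, teichmullerMod m (x i) ^ u i := by
        intro x; simp [M, map_prod]
      simp only [hM]
      refine ((IsPolyIn.const 0 _).mul (IsPolyIn.prod Finset.univ (k := fun i => u i * 1)
        fun i _ => (IsPolyIn.apply i).pow (u i))).mono ?_
      simp only [mul_one, zero_add]
      refine le_trans (le_of_eq ?_) ((MvPolynomial.le_totalDegree hu).trans hd)
      rw [Finsupp.sum_fintype _ _ fun _ => rfl]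
    generalize f.support = S at key
    induction S using Finset.induction_on with
    | empty =>
      intro k
      simpa using IsPolyIn.const (T := teichmullerMod (p := p) m) (k * d)
        (((Nat.choose 0 k : ℕ)) : ZMod (p ^ m))
    | insert u S hu ih =>
      intro k
      have ih := ih fun v hv => key v (by simp [hv])
      -- Vandermonde's identity splits the binomial over the monomials while the total lower index
      -- stays `k`.
      simp only [Finset.sum_insert hu, Nat.add_choose_eq, Nat.cast_sum, Nat.cast_mul]
      refine IsPolyIn.sum _ fun ij hij => ?_
      have := (key u (by simp) ij.1).mul (ih ij.2)
      rwa [← add_mul, Finset.HasAntidiagonal.mem_antidiagonal.1 hij] at this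

end Teichmuller

/-! ### Ax–Katz over the prime field -/

/-- The Ax–Katz theorem over a prime field. -/
theorem ax_katz_zmod {p : ℕ} [hp : Fact p.Prime] {σ ι : Type*} [Fintype σ] [Fintype ι]
    (f : ι → MvPolynomial σ (ZMod p)) (d : ι → ℕ) (D m : ℕ)
    (hd : ∀ j, (f j).totalDegree ≤ d j) (hD : ∀ j, d j ≤ D) (hD0 : 0 < D)
    (hm : ∑ j, d j + D * m < Fintype.card σ + D) :
    p ^ m ∣ Nat.card {x : σ → ZMod p // ∀ j, MvPolynomial.eval x (f j) = 0} := by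
  classical
  rw [← ZMod.natCast_eq_zero_iff]
  obtain ⟨c, hc, hcs⟩ := exists_indicator_dvd_eq_sum_choose hp.out
  choose t ht htk using fun j => exists_lift_isPolyIn_choose (p := p) m (f j) (hd j)
  obtain ⟨B, hB⟩ : ∃ B, ∀ j x, t j x < B := by
    refine ⟨(∑ j, ∑ x, t j x) + 1, fun j x => Nat.lt_succ_of_le ?_⟩
    exact (Finset.single_le_sum (f := fun x => t j x) (fun _ _ => Nat.zero_le _)
      (Finset.mem_univ x)).trans
      (Finset.single_le_sum (f := fun j => ∑ x, t j x) (fun _ _ => Nat.zero_le _)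
        (Finset.mem_univ j))
  have hind : ∀ j x, (if MvPolynomial.eval x (f j) = 0 then 1 else 0 : ZMod (p ^ m)) =
      ∑ k ∈ Finset.range B, (c k : ZMod (p ^ m)) * ((t j x).choose k : ZMod (p ^ m)) := by
    intro j x
    have h1 := congrArg (Int.cast : ℤ → ZMod (p ^ m)) (hcs (t j x) B (hB j x))
    push_cast at h1
    rw [← h1]
    simp only [← ht, ZMod.natCast_eq_zero_iff]
  have hcount : ((Nat.card {x : σ → ZMod p // ∀ j, MvPolynomial.eval x (f j) = 0} : ℕ) :
      ZMod (p ^ m)) = ∑ x : σ → ZMod p, ∏ j,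
        (if MvPolynomial.eval x (f j) = 0 then 1 else 0 : ZMod (p ^ m)) := by
    simp only [Fintype.prod_boole]
    rw [Nat.card_eq_fintype_card, Fintype.card_subtype, Finset.sum_boole]
  rw [hcount]
  simp only [hind, Finset.prod_univ_sum]
  rw [Finset.sum_comm]
  refine Finset.sum_eq_zero fun k _ => ?_
  simp only [Finset.prod_mul_distrib]
  rw [← Finset.mul_sum]
  -- The Fleck exponent; truncated subtraction makes it `0` at `k j = 0`.
  set s : ι → ℕ := fun j => (k j - 1) / (p - 1) with hs
  have hp1 : 0 < p - 1 := by have := hp.out.two_le; omega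
  have hks : ∀ j, k j ≤ (p - 1) * (s j + 1) := by
    intro j
    have h1 := Nat.mod_add_div (k j - 1) (p - 1)
    have h2 := Nat.mod_lt (k j - 1) hp1
    rw [mul_add, mul_one]
    change _ ≤ (p - 1) * ((k j - 1) / (p - 1)) + _
    omega
  have hdvd1 : (p : ZMod (p ^ m)) ^ (∑ j, s j) ∣ ∏ j, (c (k j) : ZMod (p ^ m)) := by
    rw [← Finset.prod_pow_eq_pow_sum]
    refine Finset.prod_dvd_prod_of_dvd _ _ fun j _ => ?_
    have := map_dvd (Int.castRingHom (ZMod (p ^ m))) (hc (k j))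
    simpa using this
  have hdvd2 : (p : ZMod (p ^ m)) ^ (Fintype.card σ - ∑ j, (s j + 1) * d j) ∣
      ∑ x : σ → ZMod p, ∏ j, ((t j x).choose (k j) : ZMod (p ^ m)) := by
    refine pow_dvd_sum_of_isPolyIn (T := teichmullerMod (p := p) m) hp.out.one_lt
      (fun e he => dvd_sum_teichmullerMod_pow m he) ?_
    refine (IsPolyIn.prod Finset.univ fun j _ => htk j (k j)).mono ?_
    rw [Finset.mul_sum]
    refine Finset.sum_le_sum fun j _ => ?_
    rw [← mul_assoc]
    exact Nat.mul_le_mul_right _ (hks j)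
  -- Raising `s j` by one gains a factor `p` from `c` and loses at most `d j ≤ D` from the point
  -- sum. Comparing after multiplication by `D` avoids division and, via `z ≤ D * z`, covers
  -- truncation of the second exponent to `0`.
  have hle : m ≤ ∑ j, s j + (Fintype.card σ - ∑ j, (s j + 1) * d j) := by
    have h1 : ∑ j, (s j + 1) * d j = ∑ j, s j * d j + ∑ j, d j := by
      simp only [add_mul, one_mul, Finset.sum_add_distrib]
    have h2 : ∑ j, s j * d j ≤ D * ∑ j, s j := by
      rw [Finset.mul_sum]
      exact Finset.sum_le_sum fun j _ => by rw [mul_comm]; exact Nat.mul_le_mul_right _ (hD j)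
    set z := Fintype.card σ - ∑ j, (s j + 1) * d j with hz
    have h3 : z ≤ D * z := Nat.le_mul_of_pos_left _ hD0
    by_contra! hlt
    have h4 : D * (∑ j, s j + z + 1) ≤ D * m := Nat.mul_le_mul_left _ hlt
    rw [mul_add, mul_add, mul_one] at h4
    omega
  have h0 : (p : ZMod (p ^ m)) ^ m = 0 := by
    rw [← Nat.cast_pow]; exact ZMod.natCast_self _
  have h1 := mul_dvd_mul hdvd1 hdvd2
  rw [← pow_add] at h1
  have h2 := (pow_dvd_pow (p : ZMod (p ^ m)) hle).trans h1
  rwa [h0, zero_dvd_iff] at h2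

/-! ### Digit sums and Weil restriction to the prime field -/

theorem digitSum_eq_mod_add_div {p : ℕ} (hp : 1 < p) {k : ℕ} (hk : 0 < k) :
    digitSum p k = k % p + digitSum p (k / p) := by
  simp [digitSum, Nat.digits_def' hp hk]

theorem digitSum_pos {p : ℕ} (hp : 1 < p) (k : ℕ) (hk : 0 < k) : 0 < digitSum p k := by
  induction k using Nat.strong_induction_on with
  | _ k ih =>
    rw [digitSum_eq_mod_add_div hp hk]
    rcases Nat.eq_zero_or_pos (k % p) with h | h
    · have h1 : 0 < k / p := Nat.div_pos (Nat.le_of_dvd hk (Nat.dvd_of_mod_eq_zero h)) (by omega)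
      have := ih (k / p) (Nat.div_lt_self hk hp) h1
      omega
    · omega

section WeilRestriction

variable {p : ℕ} [hp : Fact p.Prime] {K : Type*} [Field K] [Algebra (ZMod p) K]

/-- Powers of a linear form with exponent `k` have degree at most the digit sum of `k` on
`ZMod p`-points. -/
theorem isPolyIn_linear_pow {σ S : Type*} [Fintype S] (ι : S → σ) (β : S → K) (k : ℕ) :
    IsPolyIn (algebraMap (ZMod p) K) (digitSum p k)
      (fun v : σ → ZMod p => (∑ s, algebraMap (ZMod p) K (v (ι s)) * β s) ^ k) := by
  have : CharP K p := charP_of_injective_algebraMap (algebraMap (ZMod p) K).injective p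
  have hp2 := hp.out.one_lt
  induction k using Nat.strong_induction_on generalizing β with
  | _ k ih =>
    rcases Nat.eq_zero_or_pos k with rfl | hk
    · simpa using IsPolyIn.const _ 1
    · have hlin : IsPolyIn (algebraMap (ZMod p) K) 1
          (fun v : σ → ZMod p => ∑ s, algebraMap (ZMod p) K (v (ι s)) * β s) :=
        IsPolyIn.sum _ fun s _ => by simpa using (IsPolyIn.apply (ι s)).mul (IsPolyIn.const 0 (β s))
      -- Write `k = k % p + p * (k / p)`: the `p`-th power of the form is again linear, with
      -- coefficients `β s ^ p`, so only the last digit is paid for here.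
      have h1 := (hlin.pow (k % p)).mul
        (ih (k / p) (Nat.div_lt_self hk hp2) (fun s => β s ^ p))
      rw [mul_one, ← digitSum_eq_mod_add_div hp2 hk] at h1
      convert h1 using 2 with v
      have h2 : ∑ s, algebraMap (ZMod p) K (v (ι s)) * β s ^ p =
          (∑ s, algebraMap (ZMod p) K (v (ι s)) * β s) ^ p := by
        rw [sum_pow_char]
        simp only [mul_pow, ← map_pow, ZMod.pow_card]
      rw [h2, ← pow_mul, ← pow_add, Nat.mod_add_div]

theorem isPolyIn_eval_linear {n : ℕ} {S : Fin n → Type*} [∀ i, Fintype (S i)]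
    (β : (i : Fin n) → S i → K) (F : MvPolynomial (Fin n) K) :
    IsPolyIn (algebraMap (ZMod p) K) (pWeight p F)
      (fun v : (Σ i, S i) → ZMod p => MvPolynomial.eval
        (fun i => ∑ s, algebraMap (ZMod p) K (v ⟨i, s⟩) * β i s) F) := by
  simp only [MvPolynomial.eval_eq']
  refine IsPolyIn.sum _ fun u hu => ?_
  have h1 := (IsPolyIn.const 0 (F.coeff u)).mul (IsPolyIn.prod Finset.univ fun i _ =>
    isPolyIn_linear_pow (p := p) (fun s => (⟨i, s⟩ : Σ i, S i)) (β i) (u i))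
  refine h1.mono ?_
  rw [zero_add]
  exact Finset.le_sup (f := expWeight p) hu

/-- Monomials take values in `ZMod p` at `ZMod p`-points, so the linear form `φ` can be applied
coefficientwise. With `φ` a coordinate, this turns one equation over `K` into several over `ZMod p`.
-/
theorem exists_mvPolynomial_eval_eq {σ : Type*} [Fintype σ] {k : ℕ} {g : (σ → ZMod p) → K}
    (hg : IsPolyIn (algebraMap (ZMod p) K) k g) (φ : K →ₗ[ZMod p] ZMod p) :
    ∃ G : MvPolynomial σ (ZMod p), G.totalDegree ≤ k ∧
      ∀ v, MvPolynomial.eval v G = φ (g v) := by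
  classical
  obtain ⟨P, hP, hPg⟩ := hg
  refine ⟨∑ u ∈ P.support, MvPolynomial.monomial u (φ (P.coeff u)), ?_, fun v => ?_⟩
  · refine MvPolynomial.totalDegree_finsetSum_le fun u hu => ?_
    exact (MvPolynomial.totalDegree_monomial_le _ _).trans
      ((MvPolynomial.le_totalDegree hu).trans hP)
  · rw [← hPg, MvPolynomial.eval_eq' _ P, map_sum, map_sum]
    refine Finset.sum_congr rfl fun u _ => ?_
    rw [MvPolynomial.eval_monomial, Finsupp.prod_fintype _ _ fun _ => pow_zero _]
    simp only [← map_pow, ← map_prod]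
    rw [mul_comm (P.coeff u), ← Algebra.smul_def, map_smul, smul_eq_mul, mul_comm]

end WeilRestriction

theorem finrank_zmod_eq {p : ℕ} [Fact p.Prime] {V : Type*} [AddCommGroup V] [Module (ZMod p) V]
    [Finite V] {k : ℕ} (h : Nat.card V = p ^ k) : Module.finrank (ZMod p) V = k := by
  have h1 := Module.natCard_eq_pow_finrank (K := ZMod p) (V := V)
  rw [h, Nat.card_zmod] at h1
  exact (Nat.pow_right_injective (Fact.out : p.Prime).two_le h1).symm

theorem maxPWeight_pos {n r p : ℕ} (hp : 1 < p) {K : Type*} [Field K]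
    (F : Fin r → MvPolynomial (Fin n) K) (hF : ∃ j, 0 < (F j).totalDegree) :
    0 < maxPWeight p F := by
  obtain ⟨j, hj⟩ := hF
  obtain ⟨u, hu, hu0⟩ : ∃ u ∈ (F j).support, 0 < u.sum fun _ e => e := by
    by_contra! h
    exact hj.ne' (Nat.le_zero.1 (Finset.sup_le h))
  rw [Finsupp.sum_fintype _ _ fun _ => rfl] at hu0
  obtain ⟨i, _, hi⟩ := Finset.exists_ne_zero_of_sum_ne_zero hu0.ne'
  have h1 : 0 < expWeight p u := (digitSum_pos hp _ (Nat.pos_of_ne_zero hi)).trans_le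
    (Finset.single_le_sum (f := fun i => digitSum p (u i)) (fun _ _ => Nat.zero_le _)
      (Finset.mem_univ i))
  exact h1.trans_le ((Finset.le_sup (f := expWeight p) hu).trans
    (Finset.le_sup (f := fun j => pWeight p (F j)) (Finset.mem_univ j)))

/-! ### The main theorem -/

theorem theorem1p1 {n r : ℕ} (p a : ℕ) (hp : p.Prime) (ha : 1 ≤ a)
    (d : Fin n → ℕ) (hd : ∀ i, 1 ≤ d i)
    (K : Type*) [Field K] (hK : Nat.card K = (p ^ a) ^ (Finset.univ.lcm d))
    (L : Fin n → Subfield K) (hL : ∀ i, Nat.card (L i) = (p ^ a) ^ (d i))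
    (F : Fin r → MvPolynomial (Fin n) K) (hF : ∃ j, 0 < (F j).totalDegree) :
    p ^ (omegaBound p a d F).toNat ∣ partialCount L F := by
  classical
  have : Fact p.Prime := ⟨hp⟩
  rw [← pow_mul] at hK
  simp only [← pow_mul] at hL
  set e := Finset.univ.lcm d with he
  have hfin : Finite K := Nat.finite_of_card_ne_zero (by rw [hK]; exact pow_ne_zero _ hp.ne_zero)
  have hchar : CharP K p := by
    have := Fintype.ofFinite K
    exact charP_of_card_eq_prime_pow (f := a * e) (by rw [← Nat.card_eq_fintype_card, hK])
  have : Algebra (ZMod p) K := ZMod.algebra K p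
  let b : ∀ i, Module.Basis (Fin (a * d i)) (ZMod p) (L i) := fun i =>
    Module.finBasisOfFinrankEq _ _ (finrank_zmod_eq (hL i))
  let bK : Module.Basis (Fin (a * e)) (ZMod p) K :=
    Module.finBasisOfFinrankEq _ _ (finrank_zmod_eq hK)
  let Φ : ((Σ i, Fin (a * d i)) → ZMod p) ≃ ((i : Fin n) → L i) :=
    (Equiv.piCurry _).trans (Equiv.piCongrRight fun i => (b i).equivFun.symm.toEquiv)
  have hΦ : ∀ v i, (Φ v i : K) = ∑ s, algebraMap (ZMod p) K (v ⟨i, s⟩) * (b i s : K) := by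
    intro v i
    have : Φ v i = ∑ s, v ⟨i, s⟩ • b i s := (b i).equivFun_symm_apply _
    rw [this, AddSubmonoidClass.coe_finsetSum]
    exact Finset.sum_congr rfl fun s _ => Algebra.smul_def _ _
  choose G hGd hGe using fun j : Fin r × Fin (a * e) => exists_mvPolynomial_eval_eq
    (isPolyIn_eval_linear (p := p) (fun i s => (b i s : K)) (F j.1)) (bK.coord j.2)
  have hcount : partialCount L F = Nat.card {v : (Σ i, Fin (a * d i)) → ZMod p //
      ∀ j, MvPolynomial.eval v (G j) = 0} := by
    refine (Nat.card_congr (Equiv.subtypeEquiv Φ fun v => ?_)).symm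
    simp only [hGe, hΦ, Prod.forall]
    exact forall_congr' fun j => bK.forall_coord_eq_zero_iff
  rw [hcount]
  rcases le_or_gt (omegaBound p a d F) 0 with h0 | h0
  · simp [Int.toNat_of_nonpos h0]
  have hD := maxPWeight_pos hp.one_lt F hF
  refine ax_katz_zmod G (fun j => pWeight p (F j.1)) (maxPWeight p F) _ hGd
    (fun j => Finset.le_sup (f := fun j => pWeight p (F j)) (Finset.mem_univ j.1)) hD ?_
  have hDq : (0 : ℚ) < maxPWeight p F := by exact_mod_cast hD
  -- `⌈x⌉ < x + 1`, cleared of its denominator, is exactly the numerical hypothesis of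
  -- `ax_katz_zmod`.
  have h1 := Int.ceil_lt_add_one ((a : ℚ) * (((∑ i, (d i : ℚ)) - (e : ℕ) *
    ∑ j, (pWeight p (F j) : ℚ)) / (maxPWeight p F : ℚ)))
  change ((omegaBound p a d F : ℤ) : ℚ) < _ at h1
  have h2 : ((omegaBound p a d F : ℤ) : ℚ) = ((omegaBound p a d F).toNat : ℚ) := by
    have := Int.toNat_of_nonneg h0.le
    exact_mod_cast this.symm
  rw [h2, ← mul_div_assoc, ← sub_lt_iff_lt_add, lt_div_iff₀ hDq] at h1
  have h3 : ∑ j : Fin r × Fin (a * e), pWeight p (F j.1) = a * e * ∑ j, pWeight p (F j) := by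
    rw [Fintype.sum_prod_type, Finset.mul_sum]
    simp
  have h4 : Fintype.card (Σ i, Fin (a * d i)) = a * ∑ i, d i := by
    simp [Finset.mul_sum]
  rw [h3, h4, ← Nat.cast_lt (α := ℚ)]
  push_cast
  linarith
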